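/- Let $a>0$. The Buckley--Osthus random graph $H_{a,1}^n$ is the random (multi)graph with vertices $1,\dots,n$ constructed as follows. $H_{a,1}^0$ is the empty graph. Given $H_{a,1}^{r-1}$, one adds the vertex $r$ and one edge joining $r$ to a random vertex $i\in\{1,\dots,r\}$ (a loop if $i=r$), where, conditionally on $H_{a,1}^{r-1}$, $$\mathsf P(i=j)=\frac{d_{r-1}(j)-1+a}{(a+1)r-1}\quad(1\le j\le r-1),\qquad \mathsf P(i=r)=\frac{a}{(a+1)r-1},$$ and $d_{r-1}(j)$ is the degree of $j$ in $H_{a,1}^{r-1}$ (a loop contributes $2$ to the degree). The second degree $d_2(v)$ of a vertex $v$ is the number of edges that are not incident with $v$ and have an end point adjacent to $v$. Let $Y_n(k)$ be the number of vertices $v$ of $H_{a,1}^n$ with $d_2(v)\ge k$. Theorem. Let $n,k,s\in\mathbb N$, let $t>0$, and let $f$ be a real-valued function with $f(s)>0$ and $f(s)^2>(2k+1)(4k+5)s$. Then $$\mathsf P\bigl(Y_n(k)\le s-t f(s)\bigr)\,\mathsf P\bigl(Y_n(k)\ge s\bigr)\le e^{-t^2/4}.$$ -/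

import Mathlib

/-- A graph on `n` vertices that can arise in the growth process with one edge per step. The vertices
are the elements of `Fin n` in order of arrival (`i : Fin n` is the vertex with label `i + 1`); vertex
`i` arrives together with one edge, which joins it to the vertex `g i`, where `g i ≤ i` and
`g i = i` gives a loop. -/
abbrev GrowthGraph (n : ℕ) : Type := (i : Fin n) → Fin ((i : ℕ) + 1)

namespace GrowthGraph

variable {n : ℕ}

/-- The vertex to which vertex `i` is joined on its arrival. -/
def target (g : GrowthGraph n) (i : Fin n) : Fin n := Fin.castLE i.isLt (g i)

/-- The edges, indexed by the steps at which they were added: the unordered pair of the end points. -/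
def edge (g : GrowthGraph n) (i : Fin n) : Sym2 (Fin n) := s(i, g.target i)

/-- The degree of a vertex; a loop contributes `2`. -/
def degree (g : GrowthGraph n) (v : Fin n) : ℕ :=
  ∑ i : Fin n, ((if i = v then 1 else 0) + (if g.target i = v then 1 else 0))

/-- `u` and `v` are joined by an edge. -/
def Adj (g : GrowthGraph n) (u v : Fin n) : Prop := ∃ i : Fin n, g.edge i = s(u, v)

instance (g : GrowthGraph n) (u v : Fin n) : Decidable (g.Adj u v) :=
  inferInstanceAs (Decidable (∃ i : Fin n, g.edge i = s(u, v)))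

/-- The second degree of `v`: the number of edges that are not incident with `v` and have an end point
that is adjacent to `v`. -/
def secondDegree (g : GrowthGraph n) (v : Fin n) : ℕ :=
  (Finset.univ.filter fun i : Fin n =>
    v ∉ g.edge i ∧ ∃ w : Fin n, w ∈ g.edge i ∧ g.Adj w v).card

/-- The number of `k`-vertices, that is, of vertices with second degree at least `k`. -/
def numKVertices (k : ℕ) (g : GrowthGraph n) : ℕ :=
  (Finset.univ.filter fun v : Fin n => k ≤ g.secondDegree v).card

theorem sum_degree (g : GrowthGraph n) : ∑ v : Fin n, g.degree v = 2 * n := by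
  unfold degree
  rw [Finset.sum_comm]
  simp [Finset.sum_add_distrib]
  ring

theorem one_le_degree (g : GrowthGraph n) (v : Fin n) : 1 ≤ g.degree v := by
  unfold degree
  refine le_trans ?_ (Finset.single_le_sum (fun i _ => Nat.zero_le _) (Finset.mem_univ v))
  simp

/-- The probability with which the new vertex `t = n + 1` is joined to the vertex `s`, given the graph
`g` on the first `n` vertices: `(deg s - 1 + a) / ((a + 1) t - 1)` for an old vertex `s`, and
`a / ((a + 1) t - 1)` for `s = t`. -/
noncomputable def attachProb (a : ℝ) (g : GrowthGraph n) (s : Fin (n + 1)) : ℝ :=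
  Fin.lastCases (motive := fun _ => ℝ)
    (a / ((a + 1) * ((n : ℝ) + 1) - 1))
    (fun v : Fin n => ((g.degree v : ℝ) - 1 + a) / ((a + 1) * ((n : ℝ) + 1) - 1)) s

theorem attachProb_denom_pos {a : ℝ} (ha : 0 < a) (n : ℕ) :
    0 < (a + 1) * ((n : ℝ) + 1) - 1 := by
  have h : (0 : ℝ) ≤ n := Nat.cast_nonneg n
  nlinarith [mul_nonneg ha.le h]

theorem attachProb_nonneg {a : ℝ} (ha : 0 < a) (g : GrowthGraph n) (s : Fin (n + 1)) :
    0 ≤ g.attachProb a s := by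
  have hd := attachProb_denom_pos ha n
  refine Fin.lastCases ?_ (fun v => ?_) s
  · simp only [attachProb, Fin.lastCases_last]
    positivity
  · simp only [attachProb, Fin.lastCases_castSucc]
    have h : (1 : ℝ) ≤ g.degree v := by exact_mod_cast g.one_le_degree v
    exact div_nonneg (by linarith) hd.le

theorem sum_attachProb {a : ℝ} (ha : 0 < a) (g : GrowthGraph n) :
    ∑ s : Fin (n + 1), g.attachProb a s = 1 := by
  have hd := attachProb_denom_pos ha n
  have h : (∑ v : Fin n, (g.degree v : ℝ)) = 2 * n := by exact_mod_cast g.sum_degree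
  rw [Fin.sum_univ_castSucc]
  simp only [attachProb, Fin.lastCases_last, Fin.lastCases_castSucc]
  rw [← Finset.sum_div, ← add_div, div_eq_one_iff_eq hd.ne']
  simp only [Finset.sum_add_distrib, Finset.sum_sub_distrib, h, Finset.sum_const,
    Finset.card_univ, Fintype.card_fin, nsmul_eq_mul]
  ring

/-- The law of the vertex to which the new vertex is joined, given the graph on the first `n`
vertices. -/
noncomputable def attachPMF (a : ℝ) (ha : 0 < a) (g : GrowthGraph n) : PMF (Fin (n + 1)) :=
  PMF.ofFintype (fun s => ENNReal.ofReal (g.attachProb a s)) (by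
    rw [← ENNReal.ofReal_sum_of_nonneg (fun s _ => attachProb_nonneg ha g s), sum_attachProb ha g,
      ENNReal.ofReal_one])

/-- Add a new vertex, joined to `s` (`s = Fin.last n` is the new vertex itself). -/
def extend (g : GrowthGraph n) (s : Fin (n + 1)) : GrowthGraph (n + 1) :=
  Fin.snoc (α := fun i : Fin (n + 1) => Fin ((i : ℕ) + 1)) g s

end GrowthGraph

/-- The law of the Buckley–Osthus random graph on `n` vertices with one edge per vertex and initial
attractiveness `a`: start from the empty graph and add the vertices one by one. -/
noncomputable def buckleyOsthus (a : ℝ) (ha : 0 < a) : (n : ℕ) → PMF (GrowthGraph n)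
  | 0 => PMF.pure (fun i => i.elim0)
  | n + 1 => (buckleyOsthus a ha n).bind fun g => (g.attachPMF a ha).map g.extend

/-! The degree of a vertex minus 1 is the number of vertices whose target it is. So the attachment
law says: a new vertex either copies the target of some earlier vertex (weight 1 for each) or takes
a prescribed vertex (weight `a` for each). These rules are independent, so the graph is a function
on a product space (`buckleyOsthus_apply`), where Talagrand's convex distance inequality holds
(`prob_mul_prob_le`).

Changing one rule may redirect many vertices, since copies propagate. But vertices redirected
together receive the same new target, so they remain siblings, and many siblings keep each other's
second degree large. Hence (`exists_certificate`) a graph with `m` `k`-vertices has weights `α` with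
`∑ α² ≤ K m`, where `K = (2k+1)(4k+5)`, such that changing the rules in `D` destroys at most `∑ i ∈
D, α i` of them.

If `m ≥ s` and another graph has only `z ≤ s - t f(s)` `k`-vertices, the set of disagreement has
weight at least `m - z ≥ t √(K m)` (`mul_sqrt_le_of_sq_gt`). So the convex distance between the two
events is at least `t`. -/

open Finset in
/-- A finite set of a linear order has an initial segment of any size up to its own. -/
theorem Finset.exists_initial_segment {ι : Type*} [LinearOrder ι] (S : Finset ι) (m : ℕ) :
    ∃ G ⊆ S, G.card = min m S.card ∧ ∀ i ∈ G, ∀ j ∈ S, j < i → j ∈ G := by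
  induction m with
  | zero => exact ⟨∅, by simp, by simp, by simp⟩
  | succ m ih =>
    obtain ⟨G, hGS, hcard, hG⟩ := ih
    rcases (S \ G).eq_empty_or_nonempty with h | h
    · have hEq : G = S := subset_antisymm hGS (sdiff_eq_empty_iff_subset.mp h)
      subst hEq
      exact ⟨G, hGS, by omega, hG⟩
    · have hm := min'_mem _ h
      set b := (S \ G).min' h
      rw [mem_sdiff] at hm
      have hlt : G.card < S.card := card_lt_card ⟨hGS, fun h' => hm.2 (h' hm.1)⟩
      refine ⟨insert b G, insert_subset hm.1 hGS, ?_, ?_⟩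
      · rw [card_insert_of_notMem hm.2]; omega
      · intro i hi j hj hji
        rw [mem_insert] at hi ⊢
        by_cases hjG : j ∈ G
        · exact Or.inr hjG
        rcases hi with rfl | hi
        · exact absurd (min'_le _ j (mem_sdiff.mpr ⟨hj, hjG⟩)) (not_le.mpr hji)
        · exact Or.inr (hG i hi j hj hji)

/-! ### Stability of second degrees under changes of the rules -/

namespace RecursiveForest

variable {n : ℕ}

/-- The indices with a given target. -/
def fiber (τ : Fin n → Fin n) (u : Fin n) : Finset (Fin n) := Finset.univ.filter fun i => τ i = u

/-- The vertices other than `u` with target `u`. -/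
def children (τ : Fin n → Fin n) (u : Fin n) : Finset (Fin n) :=
  Finset.univ.filter fun i => i ≠ u ∧ τ i = u

/-- The children of the children of `v`. -/
def grandchildren (τ : Fin n → Fin n) (v : Fin n) : Finset (Fin n) :=
  Finset.univ.filter fun i => τ i ≠ v ∧ τ (τ i) = v

/-- The second degree of a vertex in terms of the target function. -/
def forestDegree (τ : Fin n → Fin n) (v : Fin n) : ℕ :=
  (if τ v = v then 0 else (children τ (τ v)).card) + (grandchildren τ v).card

/-- The vertices of second degree at least `k`. -/
def kVertices (τ : Fin n → Fin n) (k : ℕ) : Finset (Fin n) :=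
  Finset.univ.filter fun v => k ≤ forestDegree τ v

@[simp] theorem mem_fiber {τ : Fin n → Fin n} {u i : Fin n} : i ∈ fiber τ u ↔ τ i = u := by
  simp [fiber]

@[simp] theorem mem_children {τ : Fin n → Fin n} {u i : Fin n} :
    i ∈ children τ u ↔ i ≠ u ∧ τ i = u := by
  simp [children]

@[simp] theorem mem_grandchildren {τ : Fin n → Fin n} {v i : Fin n} :
    i ∈ grandchildren τ v ↔ τ i ≠ v ∧ τ (τ i) = v := by
  simp [grandchildren]

@[simp] theorem mem_kVertices {τ : Fin n → Fin n} {k : ℕ} {v : Fin n} :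
    v ∈ kVertices τ k ↔ k ≤ forestDegree τ v := by
  simp [kVertices]

theorem card_fiber_le (τ : Fin n → Fin n) (u : Fin n) :
    (fiber τ u).card ≤ (children τ u).card + 1 := by
  have h : fiber τ u ⊆ insert u (children τ u) := by
    intro i hi
    rw [mem_fiber] at hi
    rw [Finset.mem_insert, mem_children]
    tauto
  exact (Finset.card_le_card h).trans (Finset.card_insert_le _ _)

/-- Outside `D`, the two target functions arise by the same rule: both copy the target of the same
earlier index, or both prescribe the same target. -/
def AgreeOff (D : Finset (Fin n)) (τ τ' : Fin n → Fin n) : Prop :=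
  ∀ i ∉ D, (∃ j < i, τ i = τ j ∧ τ' i = τ' j) ∨ τ' i = τ i

/-- A target changes only if the chain of copies behind it meets `D`. The chain stays among earlier
indices with the same target, so it never leaves `S`. -/
theorem AgreeOff.eqOn {D : Finset (Fin n)} {τ τ' : Fin n → Fin n} (h : AgreeOff D τ τ')
    {S : Finset (Fin n)} (hS : ∀ i ∈ S, ∀ j < i, τ j = τ i → j ∈ S) (hD : Disjoint S D) :
    ∀ i ∈ S, τ' i = τ i := by
  intro i
  induction i using WellFoundedLT.induction with
  | ind i ih =>
    intro hi
    rcases h i (Finset.disjoint_left.mp hD hi) with ⟨j, hj, h1, h2⟩ | h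
    · rw [h1, h2]; exact ih j hj (hS i hi j hj h1.symm)
    · exact h

/-- Follow the copies back from `i` until they enter `D`, at the root `r`, or end at a prescribed
vertex (`none`). Indices with a common root move together. -/
theorem AgreeOff.exists_root {D : Finset (Fin n)} {τ τ' : Fin n → Fin n} (h : AgreeOff D τ τ')
    (i : Fin n) :
    ∃ o : Option (Fin n), (o = none → τ' i = τ i) ∧
      ∀ r, o = some r → r ∈ D ∧ τ r = τ i ∧ τ' i = τ' r := by
  induction i using WellFoundedLT.induction with
  | ind i ih =>
    by_cases hi : i ∈ D
    · exact ⟨some i, by simp, by rintro r ⟨⟩; exact ⟨hi, rfl, rfl⟩⟩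
    rcases h i hi with ⟨j, hj, h1, h2⟩ | h
    · obtain ⟨o, ho, ho'⟩ := ih j hj
      exact ⟨o, by rw [h1, h2]; exact ho, by rw [h1, h2]; exact ho'⟩
    · exact ⟨none, fun _ => h, by simp⟩

/-- The first term of `forestDegree` counts `v` among the children of its parent, so `k` siblings
suffice, `v` included. -/
theorem mem_kVertices_of_siblings {τ : Fin n → Fin n} {k : ℕ} {u : Fin n} {Q : Finset (Fin n)}
    (hQ : Q ⊆ children τ u) (hk : k ≤ Q.card) : ∀ v ∈ Q, v ∈ kVertices τ k := by
  intro v hv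
  have h := hQ hv
  rw [mem_children] at h
  rw [mem_kVertices, forestDegree, h.2, if_neg (Ne.symm h.1)]
  exact (hk.trans (Finset.card_le_card hQ)).trans (Nat.le_add_right _ _)

-- Grouping the children of `u` by root gives at most `1 + (fiber τ u ∩ D).card` groups, each with a
-- single target under `τ'`. A group loses at most `k` members: either it is small, or its members
-- are siblings numerous enough to be `k`-vertices.
open Finset in
theorem card_children_lost_le {D : Finset (Fin n)} {τ τ' : Fin n → Fin n}
    (h : AgreeOff D τ τ') {k : ℕ} (hk : 1 ≤ k) {u : Fin n} (hu : k ≤ (children τ u).card) :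
    (children τ u \ kVertices τ' k).card ≤ 2 * k * (fiber τ u ∩ D).card := by
  choose ρ hnone hsome using h.exists_root
  rcases (fiber τ u ∩ D).eq_empty_or_nonempty with hD | hD
  · rw [hD, card_empty, mul_zero, Nat.le_zero, card_eq_zero, sdiff_eq_empty_iff_subset]
    refine mem_kVertices_of_siblings (u := u) (fun i hi => ?_) hu
    rw [mem_children] at hi ⊢
    refine ⟨hi.1, ?_⟩
    rw [h.eqOn (S := fiber τ u) (by simp +contextual) (disjoint_iff_inter_eq_empty.mpr hD) i
      (by simp [hi.2]), hi.2]
  set L := children τ u \ kVertices τ' k with hL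
  have hmaps : ∀ i ∈ L, ρ i ∈ insertNone (fiber τ u ∩ D) := by
    intro i hi
    rw [hL, mem_sdiff, mem_children] at hi
    rw [mem_insertNone]
    intro r hr
    obtain ⟨h1, h2, -⟩ := hsome i r hr
    exact mem_inter.mpr ⟨by rw [mem_fiber, h2, hi.1.2], h1⟩
  have hfib : ∀ o ∈ insertNone (fiber τ u ∩ D), (L.filter fun i => ρ i = o).card ≤ k := by
    intro o _
    obtain ⟨j, hj⟩ : ∃ j, ∀ i ∈ children τ u, ρ i = o → τ' i = j := by
      cases o with
      | none => exact ⟨u, fun i hi hr => (hnone i hr).trans (mem_children.mp hi).2⟩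
      | some r => exact ⟨τ' r, fun i _ hr => (hsome i r hr).2.2⟩
    -- The common new target `j` may lie in the group; it would then carry a loop and be no child of
    -- itself.
    set Q := ((children τ u).filter fun i => ρ i = o).erase j with hQ
    have hQc : Q ⊆ children τ' j := by
      intro i hi
      rw [hQ, mem_erase, mem_filter] at hi
      exact mem_children.mpr ⟨hi.1, hj i hi.2.1 hi.2.2⟩
    by_cases hc : k ≤ Q.card
    · have hs := mem_kVertices_of_siblings hQc hc
      have : (L.filter fun i => ρ i = o) ⊆ {j} := by
        intro i hi
        rw [hL, mem_filter, mem_sdiff] at hi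
        rw [mem_singleton]
        by_contra hne
        exact hi.1.2 (hs i (mem_erase.mpr ⟨hne, mem_filter.mpr ⟨hi.1.1, hi.2⟩⟩))
      exact (card_le_card this).trans (by simpa using hk)
    · have h1 : (L.filter fun i => ρ i = o) ⊆ (children τ u).filter fun i => ρ i = o :=
        filter_subset_filter _ sdiff_subset
      have h2 := card_le_card h1
      have h3 := pred_card_le_card_erase (s := (children τ u).filter fun i => ρ i = o) (a := j)
      rw [← hQ] at h3
      omega
  have hcard := card_le_mul_card_image_of_maps_to hmaps k hfib
  rw [card_insertNone] at hcard
  -- Here `k * (1 + d) ≤ 2 * k * d`, because `d ≥ 1`.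
  have hpos := hD.card_pos
  nlinarith

open Finset in
/-- The number of `k`-vertices of a recursive forest is certified by weights of small total square:
changing the attachment rule at the indices in `D` costs at most the weight of `D`. -/
theorem exists_certificate (τ : Fin n → Fin n) (k : ℕ) :
    ∃ α : Fin n → ℕ, ∑ i, α i ^ 2 ≤ (2 * k + 1) * (4 * k + 5) * (kVertices τ k).card ∧
      ∀ (τ' : Fin n → Fin n) (D : Finset (Fin n)), AgreeOff D τ τ' →
        (kVertices τ k).card ≤ (kVertices τ' k).card + ∑ i ∈ D, α i := by
  rcases Nat.eq_zero_or_pos k with rfl | hk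
  · exact ⟨fun _ => 0, by simp, fun τ' D _ => by simp [kVertices]⟩
  -- Taking the earliest grandchildren makes `G v` closed under passing to an earlier index with the
  -- same target, as `AgreeOff.eqOn` requires.
  choose G hGsub hGcard hGlow using fun v => (grandchildren τ v).exists_initial_segment k
  set Big : Finset (Fin n) := univ.filter fun u => k ≤ (children τ u).card with hBig
  -- `C v` witnesses the second degree of `v`: if `D` misses it, `v` remains a `k`-vertex. It is
  -- used only for `v ∈ B`, where a parent other than `v` has fewer than `k` children.
  set C : Fin n → Finset (Fin n) := fun v => fiber τ (τ v) ∪ (fiber τ v ∪ G v) with hC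
  set A : Finset (Fin n) := Big.biUnion (children τ) with hA
  set B : Finset (Fin n) := kVertices τ k \ A with hB
  have hmemBig : ∀ u, u ∈ Big ↔ k ≤ (children τ u).card := by simp [hBig]
  have hAK : A ⊆ kVertices τ k := by
    intro v hv
    obtain ⟨u, hu, hvu⟩ := mem_biUnion.mp hv
    exact mem_kVertices_of_siblings (Subset.refl _) ((hmemBig u).mp hu) v hvu
  have hAcard : A.card = ∑ u ∈ Big, (children τ u).card := by
    refine card_biUnion fun u _ w _ huw => disjoint_left.mpr fun i hi hi' => huw ?_
    exact (mem_children.mp hi).2.symm.trans (mem_children.mp hi').2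
  have hABcard : A.card + B.card = (kVertices τ k).card := by
    rw [hB, add_comm, card_sdiff_add_card_eq_card hAK]
  have hBsmall : ∀ v ∈ B, τ v ≠ v → τ v ∉ Big := by
    intro v hv hne hbig
    exact (mem_sdiff.mp hv).2 (mem_biUnion.mpr ⟨τ v, hbig, mem_children.mpr ⟨hne.symm, rfl⟩⟩)
  -- An index pays `2 * k` for the children lost in a big family and 1 for each witness set
  -- containing it.
  set α : Fin n → ℕ := fun i =>
    (if τ i ∈ Big then 2 * k else 0) + (B.filter fun v => i ∈ C v).card with hα
  have hsumα : ∀ D : Finset (Fin n), ∑ i ∈ D, α i =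
      ∑ u ∈ Big, 2 * k * (fiber τ u ∩ D).card + ∑ v ∈ B, (C v ∩ D).card := by
    intro D
    rw [hα, sum_add_distrib]
    congr 1
    · rw [← sum_filter, sum_const, smul_eq_mul, ← mul_sum, mul_comm]
      congr 1
      rw [card_eq_sum_card_fiberwise (f := τ) (t := Big)
        (by intro i hi; simpa using (mem_filter.mp hi).2)]
      refine sum_congr rfl fun u hu => congrArg card ?_
      ext i
      simp only [mem_filter, mem_inter, mem_fiber]
      constructor
      · rintro ⟨⟨h1, -⟩, h2⟩; exact ⟨h2, h1⟩
      · rintro ⟨h1, h2⟩; exact ⟨⟨h2, h1 ▸ hu⟩, h1⟩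
    · simp only [card_filter]
      rw [sum_comm]
      refine sum_congr rfl fun v _ => ?_
      rw [← card_filter, inter_comm, filter_mem_eq_inter]
  have hαle : ∀ i, α i ≤ 2 * k + 2 := by
    intro i
    have hsub : (B.filter fun v => i ∈ C v) ⊆
        (if τ i ∈ Big then ∅ else children τ (τ i)) ∪ {τ i, τ (τ i)} := by
      intro v hv
      rw [mem_filter, hC] at hv
      simp only [mem_union, mem_fiber] at hv
      rw [mem_union, mem_insert, mem_singleton]
      obtain ⟨hvB, h | h | h⟩ := hv
      · by_cases hvr : τ v = v
        · right; left; rw [h, hvr]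
        · left
          rw [if_neg (h ▸ hBsmall v hvB hvr), mem_children, h]
          exact ⟨Ne.symm hvr, rfl⟩
      · exact Or.inr (Or.inl h.symm)
      · exact Or.inr (Or.inr (mem_grandchildren.mp (hGsub v h)).2.symm)
    have h1 := (card_le_card hsub).trans (card_union_le _ _)
    have h2 : ({τ i, τ (τ i)} : Finset (Fin n)).card ≤ 2 := card_le_two
    simp only [hα]
    by_cases hb : τ i ∈ Big
    · rw [if_pos hb] at h1 ⊢; rw [card_empty] at h1; omega
    · rw [if_neg hb] at h1 ⊢
      rw [hmemBig] at hb; omega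
  have hBigle : ∀ u ∈ Big, (fiber τ u).card ≤ 2 * (children τ u).card := by
    intro u hu
    have := card_fiber_le τ u
    have := (hmemBig u).mp hu
    omega
  have hCle : ∀ v ∈ B, (C v).card ≤ 2 * k + (fiber τ v).card := by
    intro v hv
    have hG : (G v).card ≤ k := by rw [hGcard]; exact min_le_left _ _
    have hu := card_union_le (fiber τ v) (G v)
    by_cases hvr : τ v = v
    · have : C v = fiber τ v ∪ G v := by simp only [hC, hvr]; rw [← union_assoc, union_self]
      rw [this]; omega
    · have h1 := hBsmall v hv hvr
      rw [hmemBig] at h1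
      have h2 := card_fiber_le τ (τ v)
      have h3 := card_union_le (fiber τ (τ v)) (fiber τ v ∪ G v)
      simp only [hC]; omega
  -- With `A` and `B` read as cardinalities, big families contribute at most `4kA` and witness sets
  -- at most `2kB + (kB + 2A)`.
  have htot : ∑ i, α i ≤ (4 * k + 2) * (kVertices τ k).card := by
    rw [hsumα]
    simp only [inter_univ]
    have h1 : ∑ u ∈ Big, 2 * k * (fiber τ u).card ≤ 4 * k * A.card := by
      rw [hAcard, mul_sum]
      exact sum_le_sum fun u hu => by nlinarith [hBigle u hu]
    have h2 : ∑ v ∈ B, (C v).card ≤ 2 * k * B.card + ∑ v ∈ B, (fiber τ v).card := by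
      refine (sum_le_sum hCle).trans ?_
      rw [sum_add_distrib, sum_const, smul_eq_mul, mul_comm]
    have h3 : ∑ v ∈ B, (fiber τ v).card ≤ k * B.card + 2 * A.card := by
      have h4 : ∀ v ∈ B, (fiber τ v).card ≤
          k + (if v ∈ Big then 2 * (children τ v).card else 0) := by
        intro v _
        by_cases hb : v ∈ Big
        · rw [if_pos hb]; have := hBigle v hb; omega
        · rw [if_neg hb]; rw [hmemBig] at hb; have := card_fiber_le τ v; omega
      refine (sum_le_sum h4).trans ?_
      rw [sum_add_distrib, sum_const, smul_eq_mul, mul_comm, hAcard, mul_sum, ← sum_filter]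
      gcongr
      intro v hv
      exact (mem_filter.mp hv).2
    rw [← hABcard]
    nlinarith
  refine ⟨α, ?_, fun τ' D hD => ?_⟩
  · calc ∑ i, α i ^ 2 ≤ ∑ i, (2 * k + 2) * α i :=
          sum_le_sum fun i _ => by rw [sq]; exact Nat.mul_le_mul_right _ (hαle i)
      _ = (2 * k + 2) * ∑ i, α i := by rw [mul_sum]
      -- `(2k+2)(4k+2) = (2k+1)(4k+4)`.
      _ ≤ (2 * k + 2) * ((4 * k + 2) * (kVertices τ k).card) := Nat.mul_le_mul_left _ htot
      _ ≤ _ := by rw [← mul_assoc]; exact Nat.mul_le_mul_right _ (by nlinarith)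
  · have hsurvive : ∀ v ∈ B, v ∉ kVertices τ' k → 1 ≤ (C v ∩ D).card := by
      intro v hv hv'
      by_contra hlt
      have hdisj : Disjoint (C v) D := by
        rw [disjoint_iff_inter_eq_empty, ← card_eq_zero]; omega
      simp only [hC, disjoint_union_left] at hdisj
      obtain ⟨hd1, hd2, hd3⟩ := hdisj
      have e1 := hD.eqOn (S := fiber τ (τ v)) (by simp +contextual) hd1
      have e2 := hD.eqOn (S := fiber τ v) (by simp +contextual) hd2
      have e3 := hD.eqOn (S := G v) (fun i hi j hj hji => hGlow v i hi j (by
        have := mem_grandchildren.mp (hGsub v hi)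
        rw [mem_grandchildren, hji]; exact this) hj) hd3
      apply hv'
      have hvK := mem_kVertices.mp (mem_sdiff.mp hv).1
      have ev : τ' v = τ v := e1 v (by simp)
      have hgr : G v ⊆ grandchildren τ' v := by
        intro i hi
        have h := mem_grandchildren.mp (hGsub v hi)
        rw [mem_grandchildren, e3 i hi, e2 (τ i) (by simp [h.2])]
        exact h
      have hch : children τ (τ v) ⊆ children τ' (τ v) := by
        intro i hi
        have h := mem_children.mp hi
        rw [mem_children, e1 i (by simp [h.2])]
        exact h
      have c1 := card_le_card hgr
      have c2 := card_le_card hch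
      -- Either all grandchildren are in `G v` or `k` of them are, and either is enough.
      have c3 := hGcard v
      rw [mem_kVertices]
      rw [forestDegree] at hvK ⊢
      rw [ev]
      split_ifs at hvK ⊢ <;> omega
    have hlost : kVertices τ k \ kVertices τ' k ⊆
        Big.biUnion (fun u => children τ u \ kVertices τ' k) ∪ (B \ kVertices τ' k) := by
      intro v hv
      rw [mem_sdiff] at hv
      rw [mem_union]
      by_cases hvA : v ∈ A
      · left
        obtain ⟨u, hu, hvu⟩ := mem_biUnion.mp hvA
        exact mem_biUnion.mpr ⟨u, hu, mem_sdiff.mpr ⟨hvu, hv.2⟩⟩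
      · right
        exact mem_sdiff.mpr ⟨mem_sdiff.mpr ⟨hv.1, hvA⟩, hv.2⟩
    have h1 : (Big.biUnion (fun u => children τ u \ kVertices τ' k)).card ≤
        ∑ u ∈ Big, 2 * k * (fiber τ u ∩ D).card :=
      card_biUnion_le.trans
        (sum_le_sum fun u hu => card_children_lost_le hD hk ((hmemBig u).mp hu))
    have h2 : (B \ kVertices τ' k).card ≤ ∑ v ∈ B, (C v ∩ D).card := by
      rw [card_eq_sum_ones]
      calc ∑ v ∈ B \ kVertices τ' k, 1 ≤ ∑ v ∈ B \ kVertices τ' k, (C v ∩ D).card :=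
            sum_le_sum fun v hv => hsurvive v (mem_sdiff.mp hv).1 (mem_sdiff.mp hv).2
        _ ≤ _ := sum_le_sum_of_subset sdiff_subset
    have h3 := (card_le_card hlost).trans (card_union_le _ _)
    have h4 := card_le_card_sdiff_add_card (s := kVertices τ k) (t := kVertices τ' k)
    rw [hsumα]
    omega

end RecursiveForest

/-! ### Talagrand's convex distance inequality -/

namespace Talagrand

theorem exp_quarter_le_two : Real.exp (1 / 4) ≤ 2 := by
  have h : (1 / 4 : ℝ) ≤ Real.log 2 := by have := Real.log_two_gt_d9; linarith
  calc Real.exp (1 / 4) ≤ Real.exp (Real.log 2) := Real.exp_le_exp.mpr h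
    _ = 2 := Real.exp_log (by norm_num)

/-- The function `log x + log (2 - x) + (log x)²` vanishes at 1 and decreases on `(0, 1]`, by `log x
≤ x - 1`. -/
theorem neg_log_le_log_two_sub_add_sq {r : ℝ} (h0 : 0 < r) (h1 : r ≤ 1) :
    -Real.log r ≤ Real.log (2 - r) + Real.log r ^ 2 := by
  have hd : ∀ x ∈ Set.Ioc (0 : ℝ) 1, HasDerivAt
      (fun x => Real.log x + Real.log (2 - x) + Real.log x ^ 2)
      (x⁻¹ + (-1) / (2 - x) + 2 * Real.log x * x⁻¹) x := by
    intro x hx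
    have e1 := Real.hasDerivAt_log hx.1.ne'
    have e2 : HasDerivAt (fun x : ℝ => 2 - x) (-1) x := (hasDerivAt_id x).const_sub 2
    have e3 := e2.log (by linarith [hx.2] : (2 - x) ≠ 0)
    refine ((e1.add e3).add (e1.pow 2)).congr_deriv ?_
    norm_num
  have hanti : AntitoneOn (fun x => Real.log x + Real.log (2 - x) + Real.log x ^ 2)
      (Set.Ioc (0 : ℝ) 1) := by
    refine antitoneOn_of_deriv_nonpos (convex_Ioc 0 1)
      (fun x hx => (hd x hx).continuousAt.continuousWithinAt)
      (fun x hx => (hd x (interior_subset hx)).differentiableAt.differentiableWithinAt)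
      (fun x hx => ?_)
    have hx' := interior_subset hx
    rw [(hd x hx').deriv]
    have hlog := Real.log_le_sub_one_of_pos hx'.1
    have h2x : 0 < 2 - x := by linarith [hx'.2]
    have : x⁻¹ + (-1) / (2 - x) + 2 * Real.log x * x⁻¹ =
        ((2 - 2 * x) + 2 * Real.log x * (2 - x)) / (x * (2 - x)) := by
      have := hx'.1.ne'
      field_simp
      ring
    rw [this]
    refine div_nonpos_of_nonpos_of_nonneg ?_ (mul_pos hx'.1 h2x).le
    nlinarith [hx'.2]
  have := hanti ⟨h0, h1⟩ ⟨one_pos, le_refl 1⟩ h1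
  norm_num at this
  linarith

/-- The exponent is minimal at `l = 1 + 2 log r`, with value `-log r - (log r)²`. If this `l` is
negative, then `r ≤ 2/3`, and `l = 0` works since `exp (1/4) ≤ 4/3`. -/
theorem exists_interpolation {r : ℝ} (h0 : 0 < r) (h1 : r ≤ 1) :
    ∃ l : ℝ, 0 ≤ l ∧ l ≤ 1 ∧ Real.exp ((1 - l) ^ 2 / 4 - l * Real.log r) ≤ 2 - r := by
  have h2 : 0 < 2 - r := by linarith
  have hlog : Real.log r ≤ 0 := Real.log_nonpos h0.le h1
  by_cases h : -(1 / 2) ≤ Real.log r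
  · refine ⟨1 + 2 * Real.log r, by linarith, by linarith, ?_⟩
    rw [← Real.le_log_iff_exp_le h2]
    nlinarith [neg_log_le_log_two_sub_add_sq h0 h1]
  · refine ⟨0, le_refl _, zero_le_one, ?_⟩
    have hr : r ≤ 2 / 3 := by
      have e1 : r ≤ Real.exp (-(1 / 2)) := by
        rw [← Real.log_le_iff_le_exp h0]; linarith
      have e2 : Real.exp (-(1 / 2)) ≤ 2 / 3 := by
        rw [Real.exp_neg, inv_le_comm₀ (Real.exp_pos _) (by norm_num)]
        have := Real.add_one_le_exp (1 / 2 : ℝ)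
        norm_num at this ⊢
        linarith
      linarith
    have e3 : Real.exp (1 / 4) ≤ 4 / 3 := by
      have e4 : (1 / 4 : ℝ) ≤ Real.log (4 / 3) := by
        have := Real.one_sub_inv_le_log_of_pos (by norm_num : (0 : ℝ) < 4 / 3)
        norm_num at this ⊢
        linarith
      rwa [Real.le_log_iff_exp_le (by norm_num)] at e4
    norm_num at e3 ⊢
    linarith

variable {X : ℕ → Type*}

/-- The product weight. -/
def weight (p : ∀ i, X i → ℝ) {n : ℕ} (x : (i : Fin n) → X i) : ℝ := ∏ i : Fin n, p i (x i)

/-- Append a coordinate. -/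
def append {n : ℕ} (x : (i : Fin n) → X i) (c : X n) : (i : Fin (n + 1)) → X i :=
  Fin.snoc (α := fun i : Fin (n + 1) => X i) x c

@[simp] theorem append_castSucc {n : ℕ} (x : (i : Fin n) → X i) (c : X n) (i : Fin n) :
    append x c i.castSucc = x i :=
  Fin.snoc_castSucc (α := fun i : Fin (n + 1) => X i) c x i

@[simp] theorem append_last {n : ℕ} (x : (i : Fin n) → X i) (c : X n) :
    append x c (Fin.last n) = c :=
  Fin.snoc_last (α := fun i : Fin (n + 1) => X i) c x

/-- Sequences of length `n + 1` as pairs of a sequence of length `n` and a last coordinate. -/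
def appendEquiv (X : ℕ → Type*) (n : ℕ) :
    X n × ((i : Fin n) → X i) ≃ ((i : Fin (n + 1)) → X i) :=
  Fin.snocEquiv (fun i : Fin (n + 1) => X i)

theorem append_init_last {n : ℕ} (x : (i : Fin (n + 1)) → X i) :
    append (fun i : Fin n => x i.castSucc) (x (Fin.last n)) = x :=
  Fin.snoc_init_self (α := fun i : Fin (n + 1) => X i) x

section Fintype

variable [∀ i, Fintype (X i)]

theorem sum_append {M : Type*} [AddCommMonoid M] {n : ℕ} (F : ((i : Fin (n + 1)) → X i) → M) :
    ∑ x, F x = ∑ c : X n, ∑ x : (i : Fin n) → X i, F (append x c) := by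
  rw [← (appendEquiv X n).sum_comp, Fintype.sum_prod_type]
  rfl

end Fintype

theorem weight_append (p : ∀ i, X i → ℝ) {n : ℕ} (x : (i : Fin n) → X i) (c : X n) :
    weight p (append x c) = p n c * weight p x := by
  rw [weight, Fin.prod_univ_castSucc, mul_comm]
  simp [weight]

theorem weight_nonneg {p : ∀ i, X i → ℝ} (hp : ∀ i c, 0 ≤ p i c) {n : ℕ}
    (x : (i : Fin n) → X i) : 0 ≤ weight p x :=
  Finset.prod_nonneg fun i _ => hp i (x i)

variable [∀ i, DecidableEq (X i)]

/-- `z` lies, as far as nonnegative linear functionals can tell, above the convex hull of the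
vectors of disagreement of `x` with the elements of `A`. -/
def Dominates {n : ℕ} (A : Finset ((i : Fin n) → X i)) (x : (i : Fin n) → X i) (z : Fin n → ℝ) :
    Prop :=
  ∀ (α : Fin n → ℝ), (∀ i, 0 ≤ α i) → ∀ c : ℝ,
    (∀ y ∈ A, c ≤ ∑ i, if x i = y i then 0 else α i) → c ≤ ∑ i, α i * z i

variable [∀ i, Fintype (X i)]

/-- The sequences that become elements of `A` on appending `c`. -/
def sectionAt {n : ℕ} (A : Finset ((i : Fin (n + 1)) → X i)) (c : X n) :
    Finset ((i : Fin n) → X i) :=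
  Finset.univ.filter fun x => append x c ∈ A

/-- The sequences that become elements of `A` on appending some coordinate. -/
def projection {n : ℕ} (A : Finset ((i : Fin (n + 1)) → X i)) : Finset ((i : Fin n) → X i) :=
  Finset.univ.filter fun x => ∃ c, append x c ∈ A

/-- Points of the section agree with `c` in the last coordinate; points of the projection may
disagree there, at cost 1. Mixing them with weights `l` and `1 - l` costs `1 - l`. For `l = 0` the
section may be empty. -/
theorem Dominates.append {n : ℕ} {A : Finset ((i : Fin (n + 1)) → X i)}
    {x : (i : Fin n) → X i} {c : X n} {z z' : Fin n → ℝ} {l : ℝ} (hl0 : 0 ≤ l) (hl1 : l ≤ 1)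
    (hz : l = 0 ∨ Dominates (sectionAt A c) x z) (hz' : Dominates (projection A) x z') :
    Dominates A (append x c)
      (Fin.snoc (α := fun _ => ℝ) (fun i => l * z i + (1 - l) * z' i) (1 - l)) := by
  intro α hα b hb
  have h2 : b - α (Fin.last n) ≤ ∑ i : Fin n, α i.castSucc * z' i := by
    refine hz' (fun i => α i.castSucc) (fun i => hα _) _ fun y hy => ?_
    obtain ⟨c', hc'⟩ := (Finset.mem_filter.mp hy).2
    have := hb _ hc'
    rw [Fin.sum_univ_castSucc] at this
    simp only [append_castSucc, append_last] at this
    have h3 : (if c = c' then 0 else α (Fin.last n)) ≤ α (Fin.last n) := by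
      split_ifs
      · exact hα _
      · exact le_refl _
    linarith
  have h1 : l * b ≤ l * ∑ i : Fin n, α i.castSucc * z i := by
    rcases hz with rfl | hz
    · simp
    refine mul_le_mul_of_nonneg_left ?_ hl0
    refine hz (fun i => α i.castSucc) (fun i => hα _) _ fun y hy => ?_
    have := hb _ (Finset.mem_filter.mp hy).2
    rw [Fin.sum_univ_castSucc] at this
    simpa using this
  rw [Fin.sum_univ_castSucc]
  simp only [Fin.snoc_castSucc, Fin.snoc_last]
  have h4 : ∑ i : Fin n, α i.castSucc * (l * z i + (1 - l) * z' i) =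
      l * ∑ i : Fin n, α i.castSucc * z i + (1 - l) * ∑ i : Fin n, α i.castSucc * z' i := by
    rw [Finset.mul_sum, Finset.mul_sum, ← Finset.sum_add_distrib]
    exact Finset.sum_congr rfl fun i _ => by ring
  rw [h4]
  nlinarith [mul_le_mul_of_nonneg_left h2 (sub_nonneg.mpr hl1)]

theorem sum_sq_interpolation_le {n : ℕ} (z z' : Fin n → ℝ) {l : ℝ} (hl0 : 0 ≤ l) (hl1 : l ≤ 1) :
    ∑ i, (Fin.snoc (α := fun _ => ℝ) (fun i => l * z i + (1 - l) * z' i) (1 - l) :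
        Fin (n + 1) → ℝ) i ^ 2 ≤
      l * ∑ i, z i ^ 2 + (1 - l) * ∑ i, z' i ^ 2 + (1 - l) ^ 2 := by
  rw [Fin.sum_univ_castSucc]
  simp only [Fin.snoc_castSucc, Fin.snoc_last]
  rw [Finset.mul_sum, Finset.mul_sum, ← Finset.sum_add_distrib]
  gcongr with i
  nlinarith [mul_nonneg (mul_nonneg hl0 (sub_nonneg.mpr hl1)) (sq_nonneg (z i - z' i))]

/-- This is Hölder's inequality with exponents `1/l` and `1/(1-l)`, obtained pointwise from the
convexity of `exp` after normalising by `P` and `Q`. -/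
theorem sum_exp_interpolation_le {ι : Type*} [Fintype ι] {w u v : ι → ℝ} (hw : ∀ x, 0 ≤ w x)
    {P Q l : ℝ} (hP : 0 < P) (hQ : 0 < Q) (hl0 : 0 ≤ l) (hl1 : l ≤ 1)
    (hu : (∑ x, w x * Real.exp (u x)) * P ≤ 1) (hv : (∑ x, w x * Real.exp (v x)) * Q ≤ 1) :
    (∑ x, w x * Real.exp (l * u x + (1 - l) * v x)) * Q ≤ Real.exp (-(l * Real.log (P / Q))) := by
  have key : ∀ x, Real.exp (l * u x + (1 - l) * v x) * Q * Real.exp (l * Real.log (P / Q)) ≤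
      l * (Real.exp (u x) * P) + (1 - l) * (Real.exp (v x) * Q) := by
    intro x
    have hc := convexOn_exp.2 (Set.mem_univ (u x + Real.log P)) (Set.mem_univ (v x + Real.log Q))
      hl0 (sub_nonneg.mpr hl1) (by ring)
    simp only [smul_eq_mul] at hc
    rw [Real.exp_add (u x), Real.exp_add (v x), Real.exp_log hP, Real.exp_log hQ] at hc
    refine le_trans (le_of_eq ?_) hc
    nth_rewrite 1 [← Real.exp_log hQ]
    rw [← Real.exp_add, ← Real.exp_add, Real.log_div hP.ne' hQ.ne']
    congr 1
    ring
  rw [Real.exp_neg, ← one_div, le_div_iff₀ (Real.exp_pos _)]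
  calc (∑ x, w x * Real.exp (l * u x + (1 - l) * v x)) * Q * Real.exp (l * Real.log (P / Q))
      = ∑ x, w x * (Real.exp (l * u x + (1 - l) * v x) * Q * Real.exp (l * Real.log (P / Q))) := by
        rw [mul_assoc, Finset.sum_mul]
        exact Finset.sum_congr rfl fun x _ => by ring
    _ ≤ ∑ x, w x * (l * (Real.exp (u x) * P) + (1 - l) * (Real.exp (v x) * Q)) :=
        Finset.sum_le_sum fun x _ => mul_le_mul_of_nonneg_left (key x) (hw x)
    _ = l * ((∑ x, w x * Real.exp (u x)) * P) + (1 - l) * ((∑ x, w x * Real.exp (v x)) * Q) := by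
        rw [Finset.sum_mul, Finset.sum_mul, Finset.mul_sum, Finset.mul_sum,
          ← Finset.sum_add_distrib]
        exact Finset.sum_congr rfl fun x _ => by ring
    _ ≤ l * 1 + (1 - l) * 1 := add_le_add (mul_le_mul_of_nonneg_left hu hl0)
        (mul_le_mul_of_nonneg_left hv (sub_nonneg.mpr hl1))
    _ = 1 := by ring

theorem sum_sectionAt (p : ∀ i, X i → ℝ) {n : ℕ} (A : Finset ((i : Fin (n + 1)) → X i)) :
    ∑ x ∈ A, weight p x = ∑ c, p n c * ∑ x ∈ sectionAt A c, weight p x := by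
  have h : ∑ x ∈ A, weight p x = ∑ x, if x ∈ A then weight p x else 0 := by simp
  rw [h, sum_append]
  refine Finset.sum_congr rfl fun c _ => ?_
  rw [sectionAt, Finset.sum_filter, Finset.mul_sum]
  refine Finset.sum_congr rfl fun x _ => ?_
  rw [weight_append, mul_ite, mul_zero]

/-- **Talagrand's inequality** for finite product spaces, in exponential moment form. -/
theorem exists_dominating {p : ∀ i, X i → ℝ} (hp : ∀ i c, 0 ≤ p i c) (hp1 : ∀ i, ∑ c, p i c = 1)
    (n : ℕ) (A : Finset ((i : Fin n) → X i)) (hA : 0 < ∑ x ∈ A, weight p x) :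
    ∃ z : ((i : Fin n) → X i) → Fin n → ℝ, (∀ x, Dominates A x (z x)) ∧
      (∑ x, weight p x * Real.exp ((∑ i, z x i ^ 2) / 4)) * ∑ x ∈ A, weight p x ≤ 1 := by
  induction n with
  | zero =>
    refine ⟨fun _ _ => 0, fun x α _ c hc => ?_, ?_⟩
    · have hne : A.Nonempty := by
        rw [Finset.nonempty_iff_ne_empty]; rintro rfl; simp at hA
      obtain ⟨y, hy⟩ := hne
      simpa using hc y hy
    · have h1 : ∀ x : (i : Fin 0) → X i, weight p x = 1 := fun x => by simp [weight]
      simp only [h1]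
      have : A.card ≤ 1 := by simpa using Finset.card_le_univ A
      simpa using this
  | succ n ih =>
    set Q := ∑ x ∈ projection A, weight p x with hQ
    have hle : ∀ c, ∑ x ∈ sectionAt A c, weight p x ≤ Q := by
      intro c
      refine Finset.sum_le_sum_of_subset_of_nonneg (fun x hx => ?_) fun x _ _ => weight_nonneg hp x
      exact Finset.mem_filter.mpr ⟨Finset.mem_univ _, c, (Finset.mem_filter.mp hx).2⟩
    have hAsum := sum_sectionAt p A
    have hAQ : ∑ x ∈ A, weight p x ≤ Q := by
      rw [hAsum]
      calc ∑ c, p n c * ∑ x ∈ sectionAt A c, weight p x ≤ ∑ c, p n c * Q :=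
            Finset.sum_le_sum fun c _ => mul_le_mul_of_nonneg_left (hle c) (hp n c)
        _ = Q := by rw [← Finset.sum_mul, hp1, one_mul]
    have hQpos : 0 < Q := hA.trans_le hAQ
    obtain ⟨z', hz', hz'sum⟩ := ih (projection A) hQpos
    have hslice : ∀ c : X n, ∃ ζ : ((i : Fin n) → X i) → Fin (n + 1) → ℝ,
        (∀ x, Dominates A (append x c) (ζ x)) ∧
        (∑ x, weight p x * Real.exp ((∑ i, ζ x i ^ 2) / 4)) * Q ≤
          2 - (∑ x ∈ sectionAt A c, weight p x) / Q := by
      intro c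
      obtain ⟨l, z, hl0, hl1, hz, hsum⟩ : ∃ (l : ℝ) (z : ((i : Fin n) → X i) → Fin n → ℝ),
          0 ≤ l ∧ l ≤ 1 ∧ (∀ x, l = 0 ∨ Dominates (sectionAt A c) x (z x)) ∧
          (∑ x, weight p x * Real.exp (l * ((∑ i, z x i ^ 2) / 4) +
            (1 - l) * ((∑ i, z' x i ^ 2) / 4))) * Q * Real.exp ((1 - l) ^ 2 / 4) ≤
          2 - (∑ x ∈ sectionAt A c, weight p x) / Q := by
        -- A section of weight 0 is outside the induction hypothesis, so only the projection is
        -- used, with `l = 0`.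
        rcases (Finset.sum_nonneg fun x (_ : x ∈ sectionAt A c) =>
          weight_nonneg hp x).eq_or_lt with h0 | hpos
        · refine ⟨0, fun _ _ => 0, le_refl _, zero_le_one, fun _ => Or.inl rfl, ?_⟩
          rw [← h0]
          simp only [zero_mul, sub_zero, one_mul, zero_add, zero_div, one_pow]
          calc _ ≤ 1 * Real.exp (1 / 4) :=
                mul_le_mul_of_nonneg_right hz'sum (Real.exp_pos _).le
            _ ≤ 2 := by rw [one_mul]; exact exp_quarter_le_two
        · obtain ⟨z, hz, hzsum⟩ := ih (sectionAt A c) hpos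
          obtain ⟨l, hl0, hl1, hl⟩ := exists_interpolation (div_pos hpos hQpos)
            ((div_le_one hQpos).mpr (hle c))
          refine ⟨l, z, hl0, hl1, fun x => Or.inr (hz x), ?_⟩
          refine le_trans ?_ hl
          rw [sub_eq_add_neg ((1 - l) ^ 2 / 4), add_comm, Real.exp_add]
          exact mul_le_mul_of_nonneg_right (sum_exp_interpolation_le (weight_nonneg hp) hpos hQpos
            hl0 hl1 hzsum hz'sum) (Real.exp_pos _).le
      refine ⟨fun x => Fin.snoc (α := fun _ => ℝ) (fun i => l * z x i + (1 - l) * z' x i) (1 - l),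
        fun x => Dominates.append hl0 hl1 (hz x) (hz' x), le_trans ?_ hsum⟩
      rw [mul_right_comm]
      refine mul_le_mul_of_nonneg_right ?_ hQpos.le
      rw [Finset.sum_mul]
      refine Finset.sum_le_sum fun x _ => ?_
      rw [mul_assoc, ← Real.exp_add]
      refine mul_le_mul_of_nonneg_left (Real.exp_le_exp.mpr ?_) (weight_nonneg hp x)
      have := sum_sq_interpolation_le (z x) (z' x) hl0 hl1
      linarith
    choose ζ hζ hζsum using hslice
    refine ⟨fun x => ζ (x (Fin.last n)) (fun i => x i.castSucc), fun x => ?_, ?_⟩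
    · have := hζ (x (Fin.last n)) (fun i => x i.castSucc)
      rwa [append_init_last] at this
    · rw [sum_append]
      simp only [append_last, append_castSucc, weight_append]
      set P := ∑ x ∈ A, weight p x with hP
      have h1 : (∑ c, ∑ x : (i : Fin n) → X i, p n c * weight p x *
          Real.exp ((∑ i, ζ c x i ^ 2) / 4)) * Q ≤ 2 - P / Q := by
        calc _ = ∑ c, p n c * ((∑ x, weight p x * Real.exp ((∑ i, ζ c x i ^ 2) / 4)) * Q) := by
              rw [Finset.sum_mul]
              refine Finset.sum_congr rfl fun c _ => ?_
              rw [Finset.sum_mul, Finset.sum_mul, Finset.mul_sum]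
              exact Finset.sum_congr rfl fun x _ => by ring
          _ ≤ ∑ c, p n c * (2 - (∑ x ∈ sectionAt A c, weight p x) / Q) :=
              Finset.sum_le_sum fun c _ => mul_le_mul_of_nonneg_left (hζsum c) (hp n c)
          _ = 2 - P / Q := by
              simp only [mul_sub, Finset.sum_sub_distrib, ← Finset.sum_mul, hp1, one_mul,
                ← mul_div_assoc, ← Finset.sum_div]
              rw [hAsum]
      -- With `r = P / Q` the claim reduces to `(2 - r) * r ≤ 1`.
      have hr : P = P / Q * Q := by field_simp
      rw [hr, mul_comm (P / Q), ← mul_assoc]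
      have hr0 : 0 ≤ P / Q := (div_pos hA hQpos).le
      nlinarith [mul_le_mul_of_nonneg_right h1 hr0, sq_nonneg (1 - P / Q)]

/-- **Talagrand's inequality** for finite product spaces: if every element of `B` has convex
distance at least `t` from `A`, then `P(A) P(B) ≤ exp (-t² / 4)`. -/
theorem prob_mul_prob_le {p : ∀ i, X i → ℝ} (hp : ∀ i c, 0 ≤ p i c) (hp1 : ∀ i, ∑ c, p i c = 1)
    {n : ℕ} (A B : Finset ((i : Fin n) → X i)) {t : ℝ} (ht : 0 ≤ t)
    (h : ∀ x ∈ B, ∃ α : Fin n → ℝ, (∀ i, 0 ≤ α i) ∧ ∃ L : ℝ, 0 < L ∧ ∑ i, α i ^ 2 ≤ L ^ 2 ∧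
      ∀ y ∈ A, t * L ≤ ∑ i, if x i = y i then 0 else α i) :
    (∑ x ∈ A, weight p x) * ∑ x ∈ B, weight p x ≤ Real.exp (-(t ^ 2 / 4)) := by
  rcases (Finset.sum_nonneg fun x (_ : x ∈ A) => weight_nonneg hp x).eq_or_lt with h0 | hpos
  · rw [← h0, zero_mul]; exact (Real.exp_pos _).le
  obtain ⟨z, hz, hsum⟩ := exists_dominating hp hp1 n A hpos
  -- Dominance bounds `t * L` by the inner product of `α` and `z x`; Cauchy–Schwarz does the rest.
  -- Markov's inequality then bounds the weight of `B`.
  have hfar : ∀ x ∈ B, t ^ 2 ≤ ∑ i, z x i ^ 2 := by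
    intro x hx
    obtain ⟨α, hα, L, hL, hαL, hy⟩ := h x hx
    have h1 := hz x α hα _ hy
    have h2 := Finset.sum_mul_sq_le_sq_mul_sq Finset.univ α (z x)
    have h3 : (t * L) ^ 2 ≤ (∑ i, α i * z x i) ^ 2 := pow_le_pow_left₀ (by positivity) h1 2
    have h4 : 0 ≤ ∑ i, z x i ^ 2 := Finset.sum_nonneg fun i _ => sq_nonneg _
    have h5 : t ^ 2 * L ^ 2 ≤ (∑ i, z x i ^ 2) * L ^ 2 := by
      nlinarith [mul_le_mul_of_nonneg_right hαL h4]
    exact le_of_mul_le_mul_right h5 (by positivity)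
  have hB : (∑ x ∈ B, weight p x) * Real.exp (t ^ 2 / 4) ≤
      ∑ x, weight p x * Real.exp ((∑ i, z x i ^ 2) / 4) := by
    rw [Finset.sum_mul]
    calc _ ≤ ∑ x ∈ B, weight p x * Real.exp ((∑ i, z x i ^ 2) / 4) :=
          Finset.sum_le_sum fun x hx => mul_le_mul_of_nonneg_left
            (Real.exp_le_exp.mpr (by linarith [hfar x hx])) (weight_nonneg hp x)
      _ ≤ _ := Finset.sum_le_sum_of_subset_of_nonneg (Finset.subset_univ _)
            fun x _ _ => mul_nonneg (weight_nonneg hp x) (Real.exp_pos _).le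
  rw [Real.exp_neg, ← one_div, le_div_iff₀ (Real.exp_pos _)]
  nlinarith [mul_le_mul_of_nonneg_right hB hpos.le]

end Talagrand

/-! ### Second degrees expressed by targets -/

namespace GrowthGraph

open RecursiveForest

variable {n : ℕ}

theorem target_le (g : GrowthGraph n) (i : Fin n) : g.target i ≤ i := by
  rw [Fin.le_def]
  exact Nat.lt_succ_iff.mp (g i).isLt

theorem adj_iff (g : GrowthGraph n) (u v : Fin n) :
    g.Adj u v ↔ g.target u = v ∨ g.target v = u := by
  simp only [Adj, edge, Sym2.eq_iff]
  constructor
  · rintro ⟨i, ⟨rfl, h⟩ | ⟨rfl, h⟩⟩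
    · exact Or.inl h
    · exact Or.inr h
  · rintro (h | h)
    · exact ⟨u, Or.inl ⟨rfl, h⟩⟩
    · exact ⟨v, Or.inr ⟨rfl, h⟩⟩

theorem not_mem_edge_and_exists_iff (g : GrowthGraph n) (v i : Fin n) :
    (v ∉ g.edge i ∧ ∃ w : Fin n, w ∈ g.edge i ∧ g.Adj w v) ↔
      i ≠ v ∧ g.target i ≠ v ∧
        (i = g.target v ∨ g.target i = g.target v ∨ g.target (g.target i) = v) := by
  simp only [adj_iff, edge, Sym2.mem_iff, not_or]
  constructor
  · rintro ⟨⟨h1, h2⟩, w, rfl | rfl, h | h⟩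
    · exact absurd h.symm h2
    · exact ⟨Ne.symm h1, Ne.symm h2, Or.inl h.symm⟩
    · exact ⟨Ne.symm h1, Ne.symm h2, Or.inr (Or.inr h)⟩
    · exact ⟨Ne.symm h1, Ne.symm h2, Or.inr (Or.inl h.symm)⟩
  · rintro ⟨h1, h2, h | h | h⟩
    · exact ⟨⟨h1.symm, h2.symm⟩, i, Or.inl rfl, Or.inr h.symm⟩
    · exact ⟨⟨h1.symm, h2.symm⟩, g.target i, Or.inr rfl, Or.inr h.symm⟩
    · exact ⟨⟨h1.symm, h2.symm⟩, g.target i, Or.inr rfl, Or.inl h⟩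

/-- If `v` has a parent `w ≠ v`, the edges counted at `w` are those of its other children and the
edge with which `w` itself arrived. The latter replaces the excluded edge of `v`, so their number is
that of the children of `w`. -/
theorem secondDegree_eq (g : GrowthGraph n) (v : Fin n) :
    g.secondDegree v = forestDegree g.target v := by
  unfold secondDegree forestDegree
  simp only [not_mem_edge_and_exists_iff]
  have hle := g.target_le
  split_ifs with hv
  · rw [zero_add]
    congr 1
    ext i
    simp only [Finset.mem_filter, Finset.mem_univ, true_and, mem_grandchildren, hv]
    constructor
    · rintro ⟨h1, h2, h | h | h⟩
      · exact absurd h h1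
      · exact absurd h h2
      · exact ⟨h2, h⟩
    · rintro ⟨h1, h2⟩
      exact ⟨fun h => h1 (by rw [h, hv]), h1, Or.inr (Or.inr h2)⟩
  · set w := g.target v with hw
    have hlt : w < v := lt_of_le_of_ne (hle v) hv
    have hvc : v ∈ children g.target w := mem_children.mpr ⟨Ne.symm hv, rfl⟩
    have hwn : w ∉ (children g.target w).erase v := by simp
    have hcard : (insert w ((children g.target w).erase v)).card = (children g.target w).card := by
      rw [Finset.card_insert_of_notMem hwn, Finset.card_erase_add_one hvc]
    rw [← hcard, ← Finset.card_union_of_disjoint]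
    · congr 1
      ext i
      simp only [Finset.mem_filter, Finset.mem_univ, true_and, mem_grandchildren,
        Finset.mem_union, Finset.mem_insert, Finset.mem_erase, mem_children]
      constructor
      · rintro ⟨h1, h2, h | h | h⟩
        · exact Or.inl (Or.inl h)
        · by_cases hi : i = w
          · exact Or.inl (Or.inl hi)
          · exact Or.inl (Or.inr ⟨h1, hi, h⟩)
        · exact Or.inr ⟨h2, h⟩
      · rintro ((rfl | ⟨h1, -, h3⟩) | ⟨h1, h2⟩)
        · exact ⟨hv, ((hle w).trans_lt hlt).ne, Or.inl rfl⟩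
        · exact ⟨h1, by rw [h3]; exact hv, Or.inr (Or.inl h3)⟩
        · refine ⟨fun h => ?_, h1, Or.inr (Or.inr h2)⟩
          rw [h, ← hw] at h2
          exact absurd h2 ((hle w).trans_lt hlt).ne
    · rw [Finset.disjoint_left]
      intro i hi hi'
      obtain ⟨-, h2⟩ := mem_grandchildren.mp hi'
      have : g.target (g.target i) ≤ w := by
        rcases Finset.mem_insert.mp hi with rfl | hi
        · exact (hle _).trans (hle _)
        · rw [(mem_children.mp (Finset.mem_of_mem_erase hi)).2]; exact hle w
      exact absurd (h2 ▸ this) (not_le.mpr hlt)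

theorem numKVertices_eq (k : ℕ) (g : GrowthGraph n) :
    g.numKVertices k = (kVertices g.target k).card := by
  simp only [numKVertices, kVertices, secondDegree_eq]

@[simp] theorem target_extend_castSucc (g : GrowthGraph n) (s : Fin (n + 1)) (i : Fin n) :
    (g.extend s).target i.castSucc = (g.target i).castSucc := by
  ext
  simp only [target, extend, Fin.val_castLE, Fin.val_castSucc]
  exact congrArg Fin.val (Fin.snoc_castSucc (α := fun i : Fin (n + 1) => Fin ((i : ℕ) + 1)) s g i)

@[simp] theorem target_extend_last (g : GrowthGraph n) (s : Fin (n + 1)) :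
    (g.extend s).target (Fin.last n) = s := by
  ext
  simp only [target, extend, Fin.val_castLE]
  exact congrArg Fin.val (Fin.snoc_last (α := fun i : Fin (n + 1) => Fin ((i : ℕ) + 1)) s g)

end GrowthGraph

/-- A rule by which vertex `i` chooses its neighbour: copy the choice of an earlier vertex, or take
a prescribed vertex. -/
abbrev AttachRule (i : ℕ) : Type := Fin i ⊕ Fin (i + 1)

/-! ### The random graph as a function of independent rules -/

namespace AttachRule

open GrowthGraph Talagrand RecursiveForest

variable {n : ℕ}

/-- The vertex chosen by a rule. -/
def resolve (g : GrowthGraph n) : AttachRule n → Fin (n + 1)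
  | Sum.inl j => (g.target j).castSucc
  | Sum.inr v => v

/-- The graph produced by a sequence of rules. -/
def toGraph : (n : ℕ) → ((i : Fin n) → AttachRule i) → GrowthGraph n
  | 0, _ => fun i => i.elim0
  | n + 1, x =>
    (toGraph n fun i => x i.castSucc).extend
      (resolve (toGraph n fun i => x i.castSucc) (x (Fin.last n)))

theorem toGraph_append (x : (i : Fin n) → AttachRule i) (c : AttachRule n) :
    toGraph (n + 1) (append x c) = (toGraph n x).extend (resolve (toGraph n x) c) := by
  simp [toGraph]

/-- A copying rule names an index, not a vertex: equal rules may yield different targets, but copied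
from the same source. -/
theorem agree_of_eq : ∀ {n : ℕ} (x y : (i : Fin n) → AttachRule i) (i : Fin n), x i = y i →
    (∃ j < i, (toGraph n x).target i = (toGraph n x).target j ∧
      (toGraph n y).target i = (toGraph n y).target j) ∨
      (toGraph n y).target i = (toGraph n x).target i
  | 0, _, _, i, _ => i.elim0
  | n + 1, x, y, i, hi => by
    induction i using Fin.lastCases with
    | last =>
      simp only [toGraph, target_extend_last, ← hi]
      rcases x (Fin.last n) with j | v
      · left
        refine ⟨j.castSucc, Fin.castSucc_lt_last j, ?_⟩
        simp [resolve]
      · right; rfl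
    | cast i =>
      rcases agree_of_eq (fun i => x i.castSucc) (fun i => y i.castSucc) i hi with
        ⟨j, hj, h1, h2⟩ | h
      · left
        refine ⟨j.castSucc, Fin.castSucc_lt_castSucc_iff.mpr hj, ?_⟩
        simp [toGraph, h1, h2]
      · right
        simp [toGraph, h]

/-- The probability of a rule: copying has weight `1`, taking a prescribed vertex has weight `a`. -/
noncomputable def prob (a : ℝ) (i : ℕ) : AttachRule i → ℝ
  | Sum.inl _ => 1 / ((a + 1) * ((i : ℝ) + 1) - 1)
  | Sum.inr _ => a / ((a + 1) * ((i : ℝ) + 1) - 1)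

theorem prob_nonneg {a : ℝ} (ha : 0 < a) (i : ℕ) (c : AttachRule i) : 0 ≤ prob a i c := by
  have hd := attachProb_denom_pos ha i
  rcases c with j | v <;> simp only [prob] <;> positivity

theorem sum_prob {a : ℝ} (ha : 0 < a) (i : ℕ) : ∑ c, prob a i c = 1 := by
  have hd := attachProb_denom_pos ha i
  rw [Fintype.sum_sum_type]
  simp only [prob, Finset.sum_const, Finset.card_univ, Fintype.card_fin, nsmul_eq_mul]
  rw [← mul_div_assoc, ← mul_div_assoc, ← add_div, div_eq_one_iff_eq hd.ne']
  push_cast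
  ring

/-- An old vertex `v` is reached by copying any of the `deg v - 1` indices with target `v`, or by
prescription; the new vertex only by prescription. -/
theorem attachProb_eq (a : ℝ) (g : GrowthGraph n) (s : Fin (n + 1)) :
    g.attachProb a s = ∑ c, if resolve g c = s then prob a n c else 0 := by
  have hinr : (∑ v : Fin (n + 1), if resolve g (Sum.inr v) = s then prob a n (Sum.inr v) else 0) =
      a / ((a + 1) * ((n : ℝ) + 1) - 1) := by
    change (∑ v : Fin (n + 1), if v = s then a / ((a + 1) * ((n : ℝ) + 1) - 1) else 0) = _
    simp
  rw [Fintype.sum_sum_type, hinr]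
  simp only [resolve, prob]
  refine Fin.lastCases ?_ (fun v => ?_) s
  · simp [attachProb, Fin.castSucc_ne_last]
  · have hdeg : (g.degree v : ℝ) = 1 + ∑ i, if g.target i = v then (1 : ℝ) else 0 := by
      simp [degree, Finset.sum_add_distrib]
    simp only [attachProb, Fin.lastCases_castSucc, Fin.castSucc_inj, hdeg]
    rw [← Finset.sum_filter, ← Finset.sum_filter, Finset.sum_const, Finset.sum_const]
    simp only [nsmul_eq_mul]
    ring

theorem buckleyOsthus_apply {a : ℝ} (ha : 0 < a) : ∀ (n : ℕ) (g : GrowthGraph n),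
    buckleyOsthus a ha n g =
      ENNReal.ofReal (∑ x, if toGraph n x = g then weight (prob a) x else 0)
  | 0, g => by
    have hg : ∀ h : GrowthGraph 0, h = g := fun h => funext fun i => i.elim0
    simp [buckleyOsthus, hg, weight]
  | n + 1, g => by
    obtain ⟨h, s, rfl⟩ : ∃ (h : GrowthGraph n) (s : Fin (n + 1)), g = h.extend s :=
      ⟨fun i => g i.castSucc, g (Fin.last n),
        (Fin.snoc_init_self (α := fun i : Fin (n + 1) => Fin ((i : ℕ) + 1)) g).symm⟩
    have hinj : ∀ (h' : GrowthGraph n) (s' : Fin (n + 1)),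
        h'.extend s' = h.extend s ↔ h' = h ∧ s' = s := fun h' s' =>
      Fin.snoc_inj (α := fun i : Fin (n + 1) => Fin ((i : ℕ) + 1))
    have hmap : ∀ h' : GrowthGraph n, ((h'.attachPMF a ha).map h'.extend) (h.extend s) =
        if h' = h then ENNReal.ofReal (h.attachProb a s) else 0 := by
      intro h'
      rw [PMF.map_apply, tsum_fintype]
      simp only [eq_comm (a := h.extend s), hinj]
      split_ifs with hh
      · subst hh
        simp [attachPMF]
      · simp [hh]
    rw [buckleyOsthus, PMF.bind_apply, tsum_fintype]
    simp only [hmap, mul_ite, mul_zero, Finset.sum_ite_eq', Finset.mem_univ, if_true]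
    rw [buckleyOsthus_apply ha n h, ← ENNReal.ofReal_mul
      (Finset.sum_nonneg fun x _ => by split_ifs; exacts [weight_nonneg (prob_nonneg ha) x, le_rfl])]
    congr 1
    rw [sum_append (X := AttachRule), attachProb_eq, mul_comm, Finset.sum_mul]
    refine Finset.sum_congr rfl fun c _ => ?_
    rw [Finset.mul_sum]
    refine Finset.sum_congr rfl fun x _ => ?_
    rw [toGraph_append, weight_append]
    simp only [hinj]
    by_cases hx : toGraph n x = h
    · subst hx; simp
    · simp [hx]

theorem measureReal_buckleyOsthus {a : ℝ} (ha : 0 < a) (n : ℕ) (P : GrowthGraph n → Prop)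
    [DecidablePred P] :
    (buckleyOsthus a ha n).toMeasure.real {g | P g} =
      ∑ x ∈ Finset.univ.filter fun x => P (toGraph n x), weight (prob a) x := by
  have hnn : ∀ x : (i : Fin n) → AttachRule i, 0 ≤ weight (prob a) x :=
    weight_nonneg (prob_nonneg ha)
  rw [MeasureTheory.measureReal_def, PMF.toMeasure_apply_fintype,
    ENNReal.toReal_sum]
  · have : ∀ g : GrowthGraph n, (({g | P g} : Set (GrowthGraph n)).indicator
        (buckleyOsthus a ha n) g).toReal =
        ∑ x, if toGraph n x = g then (if P g then weight (prob a) x else 0) else 0 := by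
      intro g
      by_cases hg : P g
      · rw [Set.indicator_of_mem (s := {g | P g}) hg, buckleyOsthus_apply, ENNReal.toReal_ofReal]
        · simp [hg]
        · exact Finset.sum_nonneg fun x _ => by split_ifs; exacts [hnn x, le_rfl]
      · rw [Set.indicator_of_notMem (s := {g | P g}) hg]; simp [hg]
    simp only [this]
    rw [Finset.sum_comm, Finset.sum_filter]
    simp
  · intro g _
    by_cases hg : P g
    · rw [Set.indicator_of_mem (s := {g | P g}) hg]; exact PMF.apply_ne_top _ _
    · rw [Set.indicator_of_notMem (s := {g | P g}) hg]; exact ENNReal.zero_ne_top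

/-- The elementary estimate that passes from the number `s` to a larger number `m`. -/
theorem mul_sqrt_le_of_sq_gt {K s m t F z : ℝ} (hK : 0 ≤ K) (hs : 0 ≤ s) (hsm : s ≤ m)
    (ht : 0 < t) (hF : 0 < F) (hFK : K * s < F ^ 2) (hz : 0 ≤ z) (hzs : z ≤ s - t * F) :
    t * √(K * m) ≤ m - z := by
  have hm : 0 ≤ m := hs.trans hsm
  rw [Real.sqrt_mul hK]
  have h1 : √K * √s ≤ F := by
    rw [← Real.sqrt_mul hK]; exact Real.sqrt_le_iff.mpr ⟨hF.le, hFK.le⟩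
  have h2 := Real.sqrt_le_sqrt hsm
  have h3 := Real.sq_sqrt hs
  have h4 := Real.sq_sqrt hm
  have h5 : t * (√K * √s) ≤ √s ^ 2 := by
    rw [h3]; linarith [mul_le_mul_of_nonneg_left h1 ht.le]
  -- Passing from `s` to `m` is harmless because `t √K ≤ √s`, a consequence of `t F ≤ s`, which
  -- holds as `z ≥ 0`.
  have h6 : t * √K * (√m - √s) ≤ m - s := by
    rcases (Real.sqrt_nonneg s).eq_or_lt with h0 | hpos
    · exfalso
      have : s = 0 := by rw [← h3, ← h0]; ring
      nlinarith [mul_pos ht hF]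
    · have h7 : t * √K ≤ √s := by
        refine le_of_mul_le_mul_right (a := √s) ?_ hpos
        linarith
      have h9 : m - s = √m ^ 2 - √s ^ 2 := by rw [h3, h4]
      rw [h9]
      nlinarith [mul_le_mul_of_nonneg_right h7 (sub_nonneg.mpr h2),
        mul_nonneg (Real.sqrt_nonneg m) (sub_nonneg.mpr h2)]
  have h8 := mul_le_mul_of_nonneg_left h1 ht.le
  nlinarith

end AttachRule

open GrowthGraph Talagrand RecursiveForest AttachRule in
theorem mainTheorem5 (a : ℝ) (ha : 0 < a) (n k s : ℕ) (t : ℝ) (ht : 0 < t)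
    (f : ℕ → ℝ) (hf_pos : 0 < f s)
    (hf : f s ^ 2 > (2 * (k : ℝ) + 1) * (4 * (k : ℝ) + 5) * (s : ℝ)) :
    (buckleyOsthus a ha n).toMeasure.real
        {g : GrowthGraph n | (g.numKVertices k : ℝ) ≤ (s : ℝ) - t * f s} *
      (buckleyOsthus a ha n).toMeasure.real
        {g : GrowthGraph n | s ≤ g.numKVertices k} ≤ Real.exp (-(t ^ 2 / 4)) := by
  classical
  rw [measureReal_buckleyOsthus, measureReal_buckleyOsthus]
  -- For `s = 0` the first event is empty. For `s > 0` the length `√(K m)` is positive, as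
  -- `prob_mul_prob_le` demands.
  rcases Nat.eq_zero_or_pos s with rfl | hs
  · have hempty : (Finset.univ.filter fun x : (i : Fin n) → AttachRule i =>
        ((toGraph n x).numKVertices k : ℝ) ≤ ((0 : ℕ) : ℝ) - t * f 0) = ∅ := by
      rw [Finset.filter_eq_empty_iff]
      intro x _ h
      have h1 := mul_pos ht hf_pos
      have h2 : (0 : ℝ) ≤ (toGraph n x).numKVertices k := Nat.cast_nonneg _
      push_cast at h
      linarith
    rw [hempty, Finset.sum_empty, zero_mul]
    exact (Real.exp_pos _).le
  refine prob_mul_prob_le (prob_nonneg ha) (sum_prob ha) _ _ ht.le fun x hx => ?_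
  have hxs := (Finset.mem_filter.mp hx).2
  obtain ⟨α, hα2, hα⟩ := exists_certificate (toGraph n x).target k
  rw [← numKVertices_eq] at hα2 hα
  set m := (toGraph n x).numKVertices k
  have hm : (0 : ℝ) < m := by exact_mod_cast hs.trans_le hxs
  have hKm : 0 < (2 * (k : ℝ) + 1) * (4 * (k : ℝ) + 5) * m := by positivity
  refine ⟨fun i => α i, fun i => Nat.cast_nonneg _, √((2 * (k : ℝ) + 1) * (4 * (k : ℝ) + 5) * m),
    Real.sqrt_pos.mpr hKm, ?_, fun y hy => ?_⟩
  · rw [Real.sq_sqrt hKm.le]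
    have h := Nat.cast_le (α := ℝ) |>.mpr hα2
    push_cast at h
    exact h
  · have hys := (Finset.mem_filter.mp hy).2
    have h1 := hα (toGraph n y).target (Finset.univ.filter fun i => x i ≠ y i) fun i hi =>
      agree_of_eq x y i (by simpa using hi)
    rw [← numKVertices_eq, Finset.sum_filter] at h1
    have h2 : (m : ℝ) ≤ (toGraph n y).numKVertices k + ∑ i, if x i = y i then (0 : ℝ) else α i := by
      refine le_trans (Nat.cast_le.mpr h1) (le_of_eq ?_)
      push_cast
      congr 1
      refine Finset.sum_congr rfl fun i _ => ?_
      by_cases h : x i = y i <;> simp [h]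
    have h3 := mul_sqrt_le_of_sq_gt (K := (2 * (k : ℝ) + 1) * (4 * (k : ℝ) + 5)) (by positivity)
      (Nat.cast_nonneg s) (Nat.cast_le.mpr hxs) ht hf_pos hf (Nat.cast_nonneg _) hys
    linarith
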